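/- **Theorem 5.2 (Gap sequence of an arbitrary word $\omega$).** Let $\sigma$ be the substitution $\sigma(a)=ab$, $\sigma(b)=aa$, let $A_m=\sigma^m(a)$ for $m\ge 0$, let $\delta_m$ be the last letter of $A_m$, and let $D_\infty=\sigma^\infty(a)=x_1x_2x_3\cdots$ be the period-doubling sequence. For $m\ge1$ let $E_{m,1}=A_m\delta_m^{-1}$ and $E_{m,2}=A_{m-1}A_m\delta_m^{-1}$ (so $A_m\delta_m^{-1}$ is $A_m$ without its last letter). Order these envelope words by the lexicographic order of their indices $(m,i)$; for a factor $\omega$ of $D_\infty$, let $Env(\omega)$ be the least envelope word $E_{m,i}$ ($m\geq 1$, $i\in\{1,2\}$) that contains $\omega$ as a factor. For $p\ge1$ let $\omega_p$ be the $p$-th occurrence of $\omega$ in $D_\infty$. If $\omega_p=x_{i+1}\cdots x_{i+n}$ and $\omega_{p+1}=x_{j+1}\cdots x_{j+n}$, the gap $G_p(\omega)$ is the word $x_{i+n+1}\cdots x_j$ if $i+n<j$, the empty word if $i+n=j$, and the inverse word $(x_{j+1}\cdots x_{i+n})^{-1}$ (in the free group on $\{a,b\}$) if $i+n>j$. Let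 $\Theta_1=\varphi_1(D_\infty)$ with $\varphi_1(a)=a$, $\varphi_1(b)=bb$, and $\Theta_2=\varphi_2(D_\infty)$ with $\varphi_2(a)=ab$, $\varphi_2(b)=acac$. Let $\omega$ be a nonempty factor of $D_\infty$. Then $\omega$ occurs in $D_\infty$ infinitely many times, and for every $m\ge1$: (1) If $Env(\omega)=E_{m,1}$, then $G_1(\omega)\ne G_2(\omega)$, and the gap sequence $\{G_p(\omega)\}_{p\ge1}$ is the sequence $\Theta_1$ with $a$ replaced by $G_1(\omega)$ and $b$ replaced by $G_2(\omega)$. (2) If $Env(\omega)=E_{m,2}$, then $G_1(\omega),G_2(\omega),G_4(\omega)$ are pairwise distinct, and the gap sequence $\{G_p(\omega)\}_{p\ge1}$ is the sequence $\Theta_2$ with $a,b,c$ replaced by $G_1(\omega),G_2(\omega),G_4(\omega)$ respectively. -/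

import Mathlib

namespace PeriodDoubling

/-- The binary alphabet `{a, b}`. -/
inductive Letter where
  | a
  | b
  deriving DecidableEq

/-- The ternary alphabet `{a, b, c}`. -/
inductive Letter₃ where
  | a
  | b
  | c
  deriving DecidableEq

/-- The factor of length `n` of the infinite word `u` that starts at the index `i`.
The letters of an infinite word are indexed from `0`. -/
def factorAt {α : Type} (u : ℕ → α) (i n : ℕ) : List α :=
  (List.range n).map (fun k => u (i + k))

/-- The finite word `w` occurs in the infinite word `u` at the index `i`. -/
def OccursAt {α : Type} (u : ℕ → α) (w : List α) (i : ℕ) : Prop :=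
  factorAt u i w.length = w

/-- The finite word `w` is a factor of the infinite word `u`. -/
def IsFactor {α : Type} (w : List α) (u : ℕ → α) : Prop :=
  ∃ i, OccursAt u w i

theorem lt_length_flatMap {α β : Type} (φ : α → List β) (hφ : ∀ x, φ x ≠ [])
    (u : ℕ → α) (n : ℕ) : n < ((factorAt u 0 (n + 1)).flatMap φ).length := by
  have h : ∀ l : List α, l.length ≤ (l.flatMap φ).length := by
    intro l
    induction l with
    | nil => simp
    | cons x l ih =>
      have := List.length_pos_of_ne_nil (hφ x)
      simp only [List.flatMap_cons, List.length_append, List.length_cons]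
      omega
  have := h (factorAt u 0 (n + 1))
  simp only [factorAt, List.length_map, List.length_range] at this ⊢
  omega

/-- The image `φ(u) = φ(u₀)φ(u₁)φ(u₂)⋯` of the infinite word `u` under a nonerasing substitution
`φ`: its letter of index `n` is read off from the finite word `φ(u₀)⋯φ(uₙ)`. -/
def substInf {α β : Type} (φ : α → List β) (hφ : ∀ x, φ x ≠ []) (u : ℕ → α) : ℕ → β :=
  fun n => ((factorAt u 0 (n + 1)).flatMap φ)[n]'(lt_length_flatMap φ hφ u n)

/-- The period-doubling substitution `σ(a) = ab`, `σ(b) = aa`. -/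
def sigma : Letter → List Letter
  | .a => [.a, .b]
  | .b => [.a, .a]

/-- `A m = σ^m(a)`. -/
def A : ℕ → List Letter
  | 0 => [.a]
  | m + 1 => (A m).flatMap sigma

theorem length_A (m : ℕ) : (A m).length = 2 ^ m := by
  have h : ∀ l : List Letter, (l.flatMap sigma).length = 2 * l.length := by
    intro l
    induction l with
    | nil => rfl
    | cons x l ih =>
      cases x <;> simp only [List.flatMap_cons, List.length_append, List.length_cons, ih, sigma,
        List.length_nil] <;> omega
  induction m with
  | zero => rfl
  | succ m ih => rw [A, h, ih, pow_succ, mul_comm]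

theorem lt_length_A (n : ℕ) : n < (A n).length := by
  rw [length_A]; exact Nat.lt_two_pow_self

/-- The period-doubling sequence `D∞ = σ^∞(a)`, the limit of the words `A m = σ^m(a)`, each of
which is a prefix of the next one. -/
def D : ℕ → Letter := fun n => (A n)[n]'(lt_length_A n)

/-- The envelope words `E_{m,1} = A_m δ_m⁻¹` and `E_{m,2} = A_{m-1} A_m δ_m⁻¹`, where `δ_m` is the
last letter of `A_m`. Only the indices `m ≥ 1` and `i ∈ {1, 2}` are used. -/
def E (m i : ℕ) : List Letter :=
  if i = 1 then (A m).dropLast else A (m - 1) ++ (A m).dropLast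

/-- The indices `(m, i)` of the envelope words that contain `w` as a factor. The type `ℕ ×ₗ ℕ`
carries the lexicographic order. -/
def envelopeIndices (w : List Letter) : Set (ℕ ×ₗ ℕ) :=
  {x | 1 ≤ (ofLex x).1 ∧ ((ofLex x).2 = 1 ∨ (ofLex x).2 = 2) ∧
    w <:+: E (ofLex x).1 (ofLex x).2}

theorem A_prefix (m k : ℕ) : A m <+: A (m + k) := by
  have h : ∀ m, A m <+: A (m + 1) := by
    intro m
    induction m with
    | zero => exact ⟨[.b], rfl⟩
    | succ m ih =>
      obtain ⟨t, ht⟩ := ih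
      refine ⟨t.flatMap sigma, ?_⟩
      rw [A, ← List.flatMap_append, ht]
      rfl
  induction k with
  | zero => exact List.prefix_refl _
  | succ k ih => exact ih.trans (h _)

theorem getElem_A (m n : ℕ) (h : n ≤ m) (hn : n < (A m).length) : (A m)[n] = D n := by
  obtain ⟨k, rfl⟩ := Nat.exists_eq_add_of_le h
  exact ((A_prefix n k).getElem (lt_length_A n)).symm

theorem envelopeIndices_nonempty {w : List Letter} (hw : IsFactor w D) :
    (envelopeIndices w).Nonempty := by
  obtain ⟨i, hi⟩ := hw
  refine ⟨toLex (i + w.length + 1, 1), by simp, by simp, ?_⟩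
  have hlen := length_A (i + w.length + 1)
  have hlt : i + w.length + 1 < 2 ^ (i + w.length + 1) := Nat.lt_two_pow_self
  have key : (((A (i + w.length + 1)).dropLast.drop i).take w.length) = w := by
    conv_rhs => rw [← hi]
    apply List.ext_getElem
    · simp only [List.length_take, List.length_drop, List.length_dropLast, hlen, factorAt,
        List.length_map, List.length_range]
      omega
    · intro k h1 h2
      have hk : k < w.length := by simpa [factorAt] using h2
      simp only [List.getElem_take, List.getElem_drop, List.getElem_dropLast, factorAt,
        List.getElem_map, List.getElem_range]
      exact getElem_A _ _ (by omega) _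
  simp only [E, ofLex_toLex, if_true]
  have h2 : ((A (i + w.length + 1)).dropLast.drop i).take w.length
      <:+: (A (i + w.length + 1)).dropLast :=
    (List.take_prefix _ _).isInfix.trans (List.drop_suffix _ _).isInfix
  rwa [key] at h2

/-- The envelope word `Env(w)` of a factor `w` of `D∞`: the minimal envelope word, in the
lexicographic order of the indices `(m, i)`, that contains `w` as a factor. -/
noncomputable def Env (w : List Letter) (hw : IsFactor w D) : List Letter :=
  let x := (wellFounded_lt (α := ℕ ×ₗ ℕ)).min (envelopeIndices w) (envelopeIndices_nonempty hw)
  E (ofLex x).1 (ofLex x).2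

/-- A finite word as an element of the free group on the alphabet, in which the inverse words
`(x₁⋯xₙ)⁻¹ = xₙ⁻¹⋯x₁⁻¹` live. -/
def toFreeGroup (w : List Letter) : FreeGroup Letter :=
  FreeGroup.mk (w.map (fun x => (x, true)))

/-- The gap in `D∞` between an occurrence at the index `i` and an occurrence at the index `j > i`
of a word of length `n`: the word strictly between them if they are separated, the empty word if
they are adjacent, and the inverse of the common part if they overlap. -/
def gapBetween (n i j : ℕ) : FreeGroup Letter :=
  if i + n ≤ j then toFreeGroup (factorAt D (i + n) (j - (i + n)))
  else (toFreeGroup (factorAt D j (i + n - j)))⁻¹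

/-- The index at which the `p`-th occurrence (`p ≥ 1`) of `w` in `D∞` starts. -/
noncomputable def occurrence (w : List Letter) (p : ℕ) : ℕ :=
  Nat.nth (OccursAt D w) (p - 1)

/-- The gap `G_p(w)` between the `p`-th and the `(p+1)`-th occurrence of `w` in `D∞`, `p ≥ 1`. -/
noncomputable def G (w : List Letter) (p : ℕ) : FreeGroup Letter :=
  gapBetween w.length (occurrence w p) (occurrence w (p + 1))

/-- The substitution `φ₁(a) = a`, `φ₁(b) = bb`. -/
def phi₁ : Letter → List Letter
  | .a => [.a]
  | .b => [.b, .b]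

/-- The substitution `φ₂(a) = ab`, `φ₂(b) = acac`. -/
def phi₂ : Letter → List Letter₃
  | .a => [.a, .b]
  | .b => [.a, .c, .a, .c]

/-- The sequence `Θ₁ = φ₁(D∞)`. -/
def Theta₁ : ℕ → Letter := substInf phi₁ (by intro x; cases x <;> simp [phi₁]) D

/-- The sequence `Θ₂ = φ₂(D∞)`. -/
def Theta₂ : ℕ → Letter₃ := substInf phi₂ (by intro x; cases x <;> simp [phi₂]) D

/-- The map of alphabets `a ↦ x`, `b ↦ y`. -/
def rename₂ {β : Type} (x y : β) : Letter → β
  | .a => x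
  | .b => y

/-- The map of alphabets `a ↦ x`, `b ↦ y`, `c ↦ z`. -/
def rename₃ {β : Type} (x y z : β) : Letter₃ → β
  | .a => x
  | .b => y
  | .c => z

end PeriodDoubling

/-! Since σ(x) = a x̄, where x̄ is the other letter, σ^k(a) and σ^k(b) differ only in their last
letter. Hence the σ^k-images of equal factors of length N remain equal for 2^k - 1 further letters
(`D_agree`). Conversely, a factor can be desubstituted once the parity of its occurrences is known.
Any b, or any length at least 3, fixes that parity, so halving ends at a or aa. Thus the occurrences
of ω are exactly the places 2^k r + d, where r runs over the occurrences of a^c with c = 1 or 2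
(`exists_occurrences_eq`). The common extension of the images σ^k(a^c) is E_{k+1,c}, and it is the
envelope of ω (`exists_envelope`). It remains to treat a and aa. Cutting D∞ into the blocks σ(x_j),
respectively σ³(x_j), shows that their return words are arranged as Θ₁ and Θ₂ (`hasReturns_one`,
`hasReturns_two`). Equal return words give equal gaps by `D_agree` (`G_congr`). Return words of
different lengths give gaps with different exponent sums in the free group (`G_ne`). -/

namespace PeriodDoubling

/-! ### Binary recursion for the letters of D∞ -/

/-- The exchange of the two letters. -/
def Letter.flip : Letter → Letter
  | .a => .b
  | .b => .a

theorem Letter.eq_a_or_eq_b (x : Letter) : x = .a ∨ x = .b := by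
  cases x <;> simp

@[simp] theorem Letter.flip_a : Letter.flip .a = .b := rfl

@[simp] theorem Letter.flip_b : Letter.flip .b = .a := rfl

@[simp] theorem Letter.flip_flip (x : Letter) : x.flip.flip = x := by
  cases x <;> rfl

theorem Letter.flip_eq_a {x : Letter} : x.flip = .a ↔ x = .b := by
  cases x <;> simp

theorem Letter.flip_injective : Function.Injective Letter.flip :=
  Function.LeftInverse.injective Letter.flip_flip

theorem getElem?_flatMap_sigma (l : List Letter) (i : ℕ) :
    (l.flatMap sigma)[2 * i]? = l[i]?.map (fun _ => Letter.a) ∧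
      (l.flatMap sigma)[2 * i + 1]? = l[i]?.map Letter.flip := by
  induction l generalizing i with
  | nil => simp
  | cons x l ih =>
    have hx : sigma x = [.a, x.flip] := by cases x <;> rfl
    cases i with
    | zero => simp [hx]
    | succ i =>
      have := ih i
      simpa [hx, show 2 * (i + 1) = 2 * i + 1 + 1 by ring] using this

theorem getElem?_A {m n : ℕ} (h : n < 2 ^ m) : (A m)[n]? = some (D n) := by
  have hm : n < (A m).length := by rwa [length_A]
  rw [List.getElem?_eq_getElem hm]
  congr 1
  rcases le_total n m with hnm | hmn
  · exact getElem_A m n hnm hm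
  · obtain ⟨k, rfl⟩ := Nat.exists_eq_add_of_le hmn
    exact (A_prefix m k).getElem hm

theorem D_even (n : ℕ) : D (2 * n) = .a := by
  have h : n < 2 ^ n := Nat.lt_two_pow_self
  have h1 := getElem?_A (m := n + 1) (n := 2 * n) (by rw [pow_succ]; omega)
  rw [A, (getElem?_flatMap_sigma _ _).1, getElem?_A h] at h1
  simpa using h1.symm

theorem D_odd (n : ℕ) : D (2 * n + 1) = (D n).flip := by
  have h : n < 2 ^ n := Nat.lt_two_pow_self
  have h1 := getElem?_A (m := n + 1) (n := 2 * n + 1) (by rw [pow_succ]; omega)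
  rw [A, (getElem?_flatMap_sigma _ _).2, getElem?_A h] at h1
  simpa using h1.symm

theorem not_D_eq_b_succ (n : ℕ) (h : D n = .b) : D (n + 1) ≠ .b := by
  intro h'
  rcases Nat.even_or_odd' n with ⟨s, rfl | rfl⟩
  · simp [D_even] at h
  · rw [show 2 * s + 1 + 1 = 2 * (s + 1) by ring, D_even] at h'
    cases h'

/-- Undoing σ would turn two such letters into the factor bb, but every b stands at an odd place.
This is what tells odd places from even ones. -/
theorem odd_D_eq_a (s : ℕ) (h : D (2 * s + 1) = .a) : D (2 * (s + 1) + 1) ≠ .a := by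
  rw [D_odd, Letter.flip_eq_a] at h
  rw [D_odd, Ne, Letter.flip_eq_a]
  exact not_D_eq_b_succ s h

/-- Four consecutive places include two consecutive odd ones. -/
theorem exists_D_eq_b (n : ℕ) : ∃ t < 4, D (n + t) ≠ .a := by
  by_contra! H
  rcases Nat.even_or_odd' n with ⟨s, rfl | rfl⟩
  · exact odd_D_eq_a s (H 1 (by omega)) (H 3 (by omega))
  · exact odd_D_eq_a s (H 0 (by omega)) (H 2 (by omega))

/-! ### Common extensions of σ^k-images, and runs of a -/

/-- If `D` has the same `N` letters at `r` and at `r'`, then the images of these factors under the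
`k`-th power of the substitution extend to a common factor. -/
theorem D_agree (k : ℕ) {N r r' : ℕ} (h : ∀ t < N, D (r + t) = D (r' + t)) :
    ∀ t, t + 1 < (N + 1) * 2 ^ k → D (2 ^ k * r + t) = D (2 ^ k * r' + t) := by
  induction k with
  | zero => intro t ht; simpa using h t (by simpa using ht)
  | succ k ih =>
    intro t ht
    have hp : ∀ r, 2 ^ (k + 1) * r = 2 * (2 ^ k * r) := fun r => by ring
    rw [show (N + 1) * 2 ^ (k + 1) = 2 * ((N + 1) * 2 ^ k) by ring] at ht
    rw [hp, hp]
    -- Even places always carry a, so agreement on L letters becomes agreement on 2L + 1, which is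
    -- how (N + 1) * 2 ^ k - 1 propagates.
    rcases Nat.even_or_odd' t with ⟨s, rfl | rfl⟩
    · rw [← mul_add, ← mul_add, D_even, D_even]
    · rw [← add_assoc, ← add_assoc, ← mul_add, ← mul_add, D_odd, D_odd, ih s (by omega)]

/-- The word `a ^ c` occurs in `D` at `r`. -/
def Runs (c r : ℕ) : Prop := ∀ t < c, D (r + t) = .a

theorem Runs.agree {c r r' : ℕ} (h : Runs c r) (h' : Runs c r') (t : ℕ) (ht : t < c) :
    D (r + t) = D (r' + t) := (h t ht).trans (h' t ht).symm

theorem runs_one {r : ℕ} : Runs 1 r ↔ D r = .a := by simp [Runs]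

theorem runs_two {r : ℕ} : Runs 2 r ↔ D r = .a ∧ D (r + 1) = .a := by
  constructor
  · intro h
    exact ⟨h 0 (by omega), h 1 (by omega)⟩
  · rintro ⟨h0, h1⟩ t ht
    interval_cases t
    exacts [h0, h1]

/-- This is σ³(x) = abaaaba x̄, with x the letter of index j. -/
theorem D_block (j : ℕ) : D (8 * j) = .a ∧ D (8 * j + 1) = .b ∧ D (8 * j + 2) = .a ∧
    D (8 * j + 3) = .a ∧ D (8 * j + 4) = .a ∧ D (8 * j + 5) = .b ∧ D (8 * j + 6) = .a ∧
    D (8 * j + 7) = (D j).flip := by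
  have e : ∀ n m, n = 2 * m → D n = .a := fun n m h => h ▸ D_even m
  have o : ∀ n m, n = 2 * m + 1 → D n = (D m).flip := fun n m h => h ▸ D_odd m
  refine ⟨e _ (4 * j) (by ring), ?_, e _ (4 * j + 1) (by ring), ?_, e _ (4 * j + 2) (by ring), ?_,
    e _ (4 * j + 3) (by ring), ?_⟩
  · rw [o _ (4 * j) (by ring), e _ (2 * j) (by ring)]; rfl
  · rw [o _ (4 * j + 1) (by ring), o _ (2 * j) (by ring), e _ j (by ring)]; rfl
  · rw [o _ (4 * j + 2) (by ring), e _ (2 * j + 1) (by ring)]; rfl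
  · rw [o _ (4 * j + 3) (by ring), o _ (2 * j + 1) (by ring), o _ j (by ring), Letter.flip_flip]

theorem runs_three_block (j : ℕ) : Runs 3 (8 * j + 2) := by
  obtain ⟨-, -, h2, h3, h4, -⟩ := D_block j
  intro t ht
  interval_cases t
  exacts [h2, h3, h4]

/-! ### Desubstitution: the occurrences of a factor -/

/-- Three letters starting at an even place have a at both ends, which `odd_D_eq_a` forbids at an
odd place. -/
theorem parity_eq {n i i₀ : ℕ} (hn : 3 ≤ n) (h : ∀ t < n, D (i + t) = D (i₀ + t)) :
    i % 2 = i₀ % 2 := by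
  have key : ∀ s s', (∀ t < 3, D (2 * s + t) = D (2 * s' + 1 + t)) → False := by
    intro s s' H
    refine odd_D_eq_a s' ?_ ?_
    · rw [← D_even s]; exact (H 0 (by omega)).symm
    · rw [← D_even (s + 1)]; exact (H 2 (by omega)).symm
  rcases Nat.even_or_odd' i with ⟨s, rfl | rfl⟩ <;>
    rcases Nat.even_or_odd' i₀ with ⟨s', rfl | rfl⟩
  · omega
  · exact (key s s' fun t ht => h t (by omega)).elim
  · exact (key s' s fun t ht => (h t (by omega)).symm).elim
  · omega

/-- Every factor of `D` has its occurrences at the places `2 ^ k * r + d`, where `r` runs over the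
occurrences of `a` (`c = 1`) or of `aa` (`c = 2`). -/
theorem exists_occurrences_eq (n : ℕ) : 1 ≤ n → ∀ i₀ : ℕ, ∃ k c d, (c = 1 ∨ c = 2) ∧
    d + n + 1 ≤ (c + 1) * 2 ^ k ∧
    ∀ i, (∀ t < n, D (i + t) = D (i₀ + t)) → ∃ r, Runs c r ∧ i = 2 ^ k * r + d := by
  induction n using Nat.strong_induction_on with
  | _ n ih =>
  intro hn i₀
  -- the inductive step, once the parity of the occurrences is known
  have step : 2 ≤ n → (∀ i, (∀ t < n, D (i + t) = D (i₀ + t)) → i % 2 = i₀ % 2) →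
      ∃ k c d, (c = 1 ∨ c = 2) ∧ d + n + 1 ≤ (c + 1) * 2 ^ k ∧
      ∀ i, (∀ t < n, D (i + t) = D (i₀ + t)) → ∃ r, Runs c r ∧ i = 2 ^ k * r + d := by
    intro h2 hpar
    -- Only odd places carry information: `(n + i₀ % 2) / 2` counts those in the window, and the
    -- offsets `2 * t + 1 - i₀ % 2` below enumerate them.
    obtain ⟨k, c, d, hc, hd, H⟩ := ih ((n + i₀ % 2) / 2) (by omega) (by omega) (i₀ / 2)
    refine ⟨k + 1, c, 2 * d + i₀ % 2, hc, ?_, ?_⟩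
    · rw [show (c + 1) * 2 ^ (k + 1) = 2 * ((c + 1) * 2 ^ k) by ring]
      omega
    · intro i hi
      have hp := hpar i hi
      obtain ⟨r, hr, hir⟩ := H (i / 2) (by
        intro t ht
        apply Letter.flip_injective
        rw [← D_odd, ← D_odd]
        have := hi (2 * t + 1 - i₀ % 2) (by omega)
        rwa [show i + (2 * t + 1 - i₀ % 2) = 2 * (i / 2 + t) + 1 by omega,
          show i₀ + (2 * t + 1 - i₀ % 2) = 2 * (i₀ / 2 + t) + 1 by omega] at this)
      refine ⟨r, hr, ?_⟩
      rw [show 2 ^ (k + 1) * r = 2 * (2 ^ k * r) by ring]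
      omega
  have odd_of_b : ∀ i, D i = .b → i % 2 = 1 := by
    intro i hi
    by_contra hcon
    rw [show i = 2 * (i / 2) by omega, D_even] at hi
    cases hi
  rcases (show n = 1 ∨ n = 2 ∨ 3 ≤ n by omega) with rfl | rfl | h3
  · rcases (D i₀).eq_a_or_eq_b with h0 | h0
    · refine ⟨0, 1, 0, Or.inl rfl, by norm_num, fun i hi => ⟨i, ?_, by simp⟩⟩
      rw [runs_one, ← h0]
      exact hi 0 (by omega)
    -- A letter b is the second letter of σ(a), hence k = 1 and d = 1.
    · refine ⟨1, 1, 1, Or.inl rfl, by norm_num, fun i hi => ⟨i / 2, ?_, ?_⟩⟩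
      · have hb : D i = .b := by rw [← h0]; exact hi 0 (by omega)
        have := odd_of_b i hb
        rw [runs_one]
        apply Letter.flip_injective
        rw [← D_odd, show 2 * (i / 2) + 1 = i by omega, hb]
        rfl
      · have hb : D i = .b := by rw [← h0]; exact hi 0 (by omega)
        have := odd_of_b i hb
        omega
  -- The word aa is terminal, since its parity is not determined; the other words of length 2
  -- contain a b, which stands at an odd place.
  · rcases (D i₀).eq_a_or_eq_b with h0 | h0
    · rcases (D (i₀ + 1)).eq_a_or_eq_b with h1 | h1
      · refine ⟨0, 2, 0, Or.inr rfl, by norm_num, fun i hi => ⟨i, ?_, by simp⟩⟩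
        rw [runs_two]
        exact ⟨(hi 0 (by omega)).trans h0, (hi 1 (by omega)).trans h1⟩
      · refine step le_rfl fun i hi => ?_
        have h1' := odd_of_b _ ((hi 1 (by omega)).trans h1)
        have h1 := odd_of_b _ h1
        omega
    · refine step le_rfl fun i hi => ?_
      have h0' := odd_of_b _ ((hi 0 (by omega)).trans h0)
      have h0 := odd_of_b _ h0
      omega
  · exact step (by omega) fun i hi => parity_eq h3 hi

/-! ### Envelope words as factors, and the envelope of a factor -/

theorem length_factorAt {α : Type} (u : ℕ → α) (i n : ℕ) : (factorAt u i n).length = n := by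
  simp [factorAt]

theorem factorAt_congr {α : Type} {u : ℕ → α} {i j n : ℕ} :
    factorAt u i n = factorAt u j n ↔ ∀ t < n, u (i + t) = u (j + t) := by
  simp [factorAt, List.map_inj_left]

theorem getElem?_factorAt {α : Type} (u : ℕ → α) {i n t : ℕ} (h : t < n) :
    (factorAt u i n)[t]? = some (u (i + t)) := by
  simp [factorAt, h]

/-- The envelope words as factors of `D`. -/
theorem E_eq_factorAt {k c : ℕ} (hc : c = 1 ∨ c = 2) :
    E (k + 1) c = factorAt D (2 ^ k * 2) ((c + 1) * 2 ^ k - 1) := by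
  have hk : 0 < 2 ^ k := by positivity
  have h0 : D 0 = .a := D_even 0
  -- The first aaa fills the places 2, 3, 4, so both a and aa occur at 2.
  obtain ⟨-, -, h2, h3, h4, -⟩ := D_block 0
  norm_num at h2 h3 h4
  have key : ∀ r', D r' = .a → ∀ t, t < 2 ^ (k + 1) - 1 → D t = D (2 ^ k * r' + t) := by
    intro r' hr t ht
    have := D_agree k (N := 1) (r := 0) (r' := r') (by simp [h0, hr]) t (by
      rw [pow_succ] at ht; omega)
    simpa using this
  have hlen : ((A (k + 1)).dropLast).length = 2 ^ (k + 1) - 1 := by simp [length_A]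
  have hget : ∀ t, t < 2 ^ (k + 1) - 1 → ((A (k + 1)).dropLast)[t]? = some (D t) := by
    intro t ht
    rw [List.getElem?_dropLast, if_pos (by simpa [length_A] using ht), getElem?_A (by omega)]
  have hs : 2 ^ (k + 1) = 2 * 2 ^ k := by ring
  rcases hc with rfl | rfl
  · apply List.ext_getElem?
    intro t
    simp only [E, if_true]
    by_cases ht : t < 2 ^ (k + 1) - 1
    · rw [hget t ht, getElem?_factorAt _ (by omega), key 2 h2 t ht]
    · rw [List.getElem?_eq_none (by omega),
        List.getElem?_eq_none (by rw [length_factorAt]; omega)]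
  · apply List.ext_getElem?
    intro t
    simp only [E, if_neg (show ¬ (2 = 1) by omega), Nat.add_sub_cancel]
    rcases lt_or_ge t (2 ^ k) with ht | ht
    · rw [List.getElem?_append_left (by rwa [length_A]), getElem?_A ht,
        getElem?_factorAt _ (by omega)]
      rcases (show t < 2 ^ (k + 1) - 1 ∨ k = 0 by
        rcases Nat.eq_zero_or_pos k with h | h
        · exact Or.inr h
        · left; have := Nat.one_lt_two_pow (n := k) (by omega); omega) with h | rfl
      · rw [key 2 h2 t h]
      · obtain rfl : t = 0 := by simpa using ht
        simp [h0, h2]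
    · rw [List.getElem?_append_right (by rwa [length_A]), length_A]
      by_cases ht' : t < 3 * 2 ^ k - 1
      · rw [hget _ (by omega), getElem?_factorAt _ (by omega), key 3 h3 _ (by omega)]
        congr 2
        omega
      · rw [List.getElem?_eq_none (by omega),
          List.getElem?_eq_none (by rw [length_factorAt]; omega)]

theorem length_E {k c : ℕ} (hc : c = 1 ∨ c = 2) :
    (E (k + 1) c).length = (c + 1) * 2 ^ k - 1 := by
  rw [E_eq_factorAt hc, length_factorAt]

theorem isInfix_factorAt_iff {α : Type} {u : ℕ → α} {w : List α} {i n : ℕ} :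
    w <:+: factorAt u i n ↔ ∃ d, d + w.length ≤ n ∧ OccursAt u w (i + d) := by
  constructor
  · rintro ⟨s, t, h⟩
    have hl := congrArg List.length h
    simp only [List.length_append, length_factorAt] at hl
    refine ⟨s.length, by omega, ?_⟩
    apply List.ext_getElem?
    intro x
    by_cases hx : x < w.length
    · have h1 : (factorAt u i n)[s.length + x]? = w[x]? := by
        rw [← h, List.append_assoc, List.getElem?_append_right (by omega),
          List.getElem?_append_left (by omega)]
        simp
      rw [getElem?_factorAt _ hx, ← h1, getElem?_factorAt _ (by omega), add_assoc]
    · rw [List.getElem?_eq_none (by rw [length_factorAt]; omega),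
        List.getElem?_eq_none (by omega)]
  · rintro ⟨d, hd, h⟩
    have : w = ((factorAt u i n).drop d).take w.length := by
      apply List.ext_getElem?
      intro x
      by_cases hx : x < w.length
      · rw [List.getElem?_take_of_lt hx, List.getElem?_drop, getElem?_factorAt _ (by omega)]
        conv_lhs => rw [← h]
        rw [getElem?_factorAt _ hx, add_assoc]
      · rw [List.getElem?_eq_none (by omega),
          List.getElem?_eq_none (by rw [List.length_take]; omega)]
    rw [this]
    exact (List.take_prefix _ _).isInfix.trans (List.drop_suffix _ _).isInfix

theorem OccursAt.iff_agree {α : Type} {u : ℕ → α} {w : List α} {i₀ i : ℕ}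
    (h : OccursAt u w i₀) : OccursAt u w i ↔ ∀ t < w.length, u (i + t) = u (i₀ + t) := by
  unfold OccursAt at *
  rw [← factorAt_congr, h]

/-- The occurrences of `w` in `D` and its envelope. -/
theorem exists_envelope {w : List Letter} (hne : w ≠ []) (hw : IsFactor w D) :
    ∃ k c d, (c = 1 ∨ c = 2) ∧ d + w.length + 1 ≤ (c + 1) * 2 ^ k ∧
      (∀ i, OccursAt D w i ↔ ∃ r, Runs c r ∧ i = 2 ^ k * r + d) ∧
      Env w hw = E (k + 1) c := by
  obtain ⟨i₀, h₀⟩ := hw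
  have hpos : 1 ≤ w.length := List.length_pos_of_ne_nil hne
  obtain ⟨k, c, d, hc, hd, H⟩ := exists_occurrences_eq w.length hpos i₀
  have hocc : ∀ i, OccursAt D w i ↔ ∃ r, Runs c r ∧ i = 2 ^ k * r + d := by
    intro i
    refine ⟨fun hi => H i (h₀.iff_agree.1 hi), ?_⟩
    rintro ⟨r, hr, rfl⟩
    obtain ⟨r₀, hr₀, rfl⟩ := H i₀ fun _ _ => rfl
    refine h₀.iff_agree.2 fun t ht => ?_
    rw [add_assoc, add_assoc]
    exact D_agree k (hr.agree hr₀) (d + t) (by omega)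
  have hruns : ∀ c', c' = 1 ∨ c' = 2 → Runs c' 2 ∧ Runs c' 3 := by
    intro c' hc'
    have h := runs_three_block 0
    exact ⟨fun t ht => h t (by omega), fun t ht => by
      rw [← h (t + 1) (by omega)]; congr 1; omega⟩
  refine ⟨k, c, d, hc, hd, hocc, ?_⟩
  have hmem : toLex (k + 1, c) ∈ envelopeIndices w := by
    refine ⟨by simp, by simpa using hc, ?_⟩
    simp only [ofLex_toLex]
    rw [E_eq_factorAt hc, isInfix_factorAt_iff]
    exact ⟨d, by omega, (hocc _).2 ⟨2, (hruns c hc).1, rfl⟩⟩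
  -- If E_{m+1,i} contains ω, every occurrence of a^i yields one of ω at a fixed offset. The places
  -- 2 and 3 give two occurrences of ω at distance 2^m, so 2^k divides 2^m.
  have hlb : ∀ x ∈ envelopeIndices w, toLex (k + 1, c) ≤ x := by
    rintro x ⟨hx1, hx2, hx3⟩
    obtain ⟨⟨m, i⟩, rfl⟩ := toLex.surjective x
    simp only [ofLex_toLex] at hx1 hx2 hx3
    obtain ⟨m, rfl⟩ : ∃ m', m = m' + 1 := ⟨m - 1, by omega⟩
    rw [E_eq_factorAt hx2, isInfix_factorAt_iff] at hx3
    obtain ⟨d', hd', hw'⟩ := hx3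
    have hall : ∀ r, Runs i r → ∃ s, Runs c s ∧ 2 ^ m * r + d' = 2 ^ k * s + d := by
      intro r hr
      rw [← hocc, hw'.iff_agree]
      intro t ht
      rw [add_assoc, add_assoc]
      exact D_agree m (hr.agree (hruns i hx2).1) (d' + t) (by omega)
    obtain ⟨s₂, hs₂, e₂⟩ := hall 2 (hruns i hx2).1
    obtain ⟨s₃, hs₃, e₃⟩ := hall 3 (hruns i hx2).2
    have hdvd : 2 ^ k ∣ 2 ^ m := by
      have h1 : 2 ^ m + 2 ^ k * s₂ = 2 ^ k * s₃ := by omega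
      exact (Nat.dvd_add_left (dvd_mul_right _ _)).1 (h1 ▸ dvd_mul_right _ _)
    have hkm : k ≤ m := (Nat.pow_dvd_pow_iff_le_right (by norm_num)).1 hdvd
    rw [Prod.Lex.toLex_le_toLex]
    rcases hkm.lt_or_eq with hlt | rfl
    · left; simpa using hlt
    · right
      refine ⟨rfl, ?_⟩
      by_contra hlt
      simp only at hlt
      obtain rfl : i = 1 := by omega
      obtain rfl : c = 2 := by omega
      -- If k = m, i = 1 and c = 2, the aaa at 2, 3, 4 would produce aa at three consecutive places,
      -- that is aaaa.
      obtain ⟨s₄, hs₄, e₄⟩ := hall 4 (runs_one.2 (runs_three_block 0 2 (by omega)))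
      have hk : 0 < 2 ^ k := by positivity
      have a3 : s₃ = s₂ + 1 := Nat.eq_of_mul_eq_mul_left hk (by rw [mul_add]; omega)
      have a4 : s₄ = s₂ + 2 := Nat.eq_of_mul_eq_mul_left hk (by rw [mul_add]; omega)
      subst a3 a4
      obtain ⟨t, ht, hb⟩ := exists_D_eq_b s₂
      rw [runs_two] at hs₂ hs₄
      interval_cases t
      exacts [hb hs₂.1, hb hs₂.2, hb hs₄.1, hb hs₄.2]
  have hmin : (wellFounded_lt (α := ℕ ×ₗ ℕ)).min (envelopeIndices w)
      (envelopeIndices_nonempty ⟨i₀, h₀⟩) = toLex (k + 1, c) :=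
    le_antisymm (not_lt.1 (WellFounded.not_lt_min (wellFounded_lt (α := ℕ ×ₗ ℕ)) _ hmem)) (hlb _ (WellFounded.min_mem _ _ _))
  simp only [Env, hmin, ofLex_toLex]

/-- Equal lengths would give 2^(k+1) = 3 · 2^m. Hence the envelope determines c. -/
theorem E_one_ne_E_two (k m : ℕ) : E (k + 1) 1 ≠ E (m + 1) 2 := by
  intro h
  have h1 := congrArg List.length h
  rw [length_E (Or.inl rfl), length_E (Or.inr rfl)] at h1
  have hk : 0 < 2 ^ k := by positivity
  have hm : 0 < 2 ^ m := by positivity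
  have h3 : 3 ∣ 2 ^ (k + 1) := ⟨2 ^ m, by rw [pow_succ]; omega⟩
  have := Nat.prime_three.dvd_of_dvd_pow h3
  omega

/-! ### Block structure of φ(u) -/

/-- Letters of `φ(u)` by blocks. -/
theorem substInf_block {α β : Type} (φ : α → List β) (hφ : ∀ x, φ x ≠ []) (u : ℕ → α) (j q : ℕ)
    (hq : q < (φ (u j)).length) :
    substInf φ hφ u (((factorAt u 0 j).flatMap φ).length + q) = (φ (u j))[q] := by
  have hpre : ∀ m n, m ≤ n → (factorAt u 0 m).flatMap φ <+: (factorAt u 0 n).flatMap φ := by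
    intro m n hmn
    obtain ⟨t, rfl⟩ := Nat.exists_eq_add_of_le hmn
    refine ⟨((List.range t).map (fun k => u (m + k))).flatMap φ, ?_⟩
    rw [← List.flatMap_append]
    simp [factorAt, List.range_add, Function.comp_def]
  set p := ((factorAt u 0 j).flatMap φ).length + q with hp
  have hsucc : (factorAt u 0 (j + 1)).flatMap φ = (factorAt u 0 j).flatMap φ ++ φ (u j) := by
    simp [factorAt, List.range_succ, List.flatMap_append]
  have hlt : p < ((factorAt u 0 (j + 1)).flatMap φ).length := by
    rw [hsucc, List.length_append]; omega
  have h1 : ((factorAt u 0 (j + 1)).flatMap φ)[p] = (φ (u j))[q] := by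
    simp only [hsucc, hp]
    rw [List.getElem_append_right (by omega)]
    simp
  rw [← h1]
  unfold substInf
  -- The letter of index p is defined from p + 1 blocks and wanted from j + 1; one of these words is
  -- a prefix of the other.
  rcases le_total (p + 1) (j + 1) with h | h
  · exact (hpre _ _ h).getElem _
  · exact ((hpre _ _ h).getElem _).symm

theorem exists_block {α β : Type} (φ : α → List β) (hφ : ∀ x, φ x ≠ []) (u : ℕ → α) (p : ℕ) :
    ∃ j q, q < (φ (u j)).length ∧ p = ((factorAt u 0 j).flatMap φ).length + q := by
  induction p with
  | zero => exact ⟨0, 0, List.length_pos_of_ne_nil (hφ _), by simp [factorAt]⟩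
  | succ p ih =>
    obtain ⟨j, q, hq, rfl⟩ := ih
    by_cases h : q + 1 < (φ (u j)).length
    · exact ⟨j, q + 1, h, by omega⟩
    · refine ⟨j + 1, 0, List.length_pos_of_ne_nil (hφ _), ?_⟩
      simp only [factorAt, List.range_succ, List.flatMap_append, List.map_append,
        List.length_append, List.map_cons, List.map_nil, List.flatMap_cons, List.flatMap_nil,
        List.length_nil, zero_add]
      omega

/-! ### Return words of a and aa -/

/-- The number `x` is the one of index `p` among those satisfying `P`. -/
def IsNth (P : ℕ → Prop) (p x : ℕ) : Prop :=
  P x ∧ Nat.nth P p = x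

theorem isNth_zero {P : ℕ → Prop} {x : ℕ} (hx : P x) (h : ∀ z < x, ¬ P z) : IsNth P 0 x := by
  classical
  refine ⟨hx, ?_⟩
  rw [Nat.nth_zero]
  exact le_antisymm (Nat.sInf_le hx) (le_csInf ⟨x, hx⟩ fun z hz => not_lt.1 fun hlt => h z hlt hz)

theorem IsNth.succ {P : ℕ → Prop} (hP : {x | P x}.Infinite) {p x : ℕ} (h : IsNth P p x) (d : ℕ)
    (hd : 0 < d) (hy : P (x + d)) (hz : ∀ e, 0 < e → e < d → ¬ P (x + e)) :
    IsNth P (p + 1) (x + d) := by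
  refine ⟨hy, ?_⟩
  have hlt : x < Nat.nth P (p + 1) := by
    rw [← h.2]; exact (Nat.nth_lt_nth hP).2 (Nat.lt_succ_self p)
  have hmem : P (Nat.nth P (p + 1)) := Nat.nth_mem_of_infinite hP _
  apply le_antisymm
  · classical
    have h4 : Nat.nth P (Nat.count P (x + d)) = x + d := Nat.nth_count hy
    have h5 : Nat.nth P p < Nat.nth P (Nat.count P (x + d)) := by rw [h4, h.2]; omega
    rw [← h4]
    exact (Nat.nth_le_nth hP).2 ((Nat.nth_lt_nth hP).1 h5)
  · by_contra hcon
    refine hz (Nat.nth P (p + 1) - x) (by omega) (by omega) ?_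
    rwa [show x + (Nat.nth P (p + 1) - x) = Nat.nth P (p + 1) by omega]

theorem infinite_runs {c : ℕ} (hc : c = 1 ∨ c = 2) : {r | Runs c r}.Infinite :=
  Set.infinite_of_injective_forall_mem (f := fun j => 8 * j + 2) (fun x y h => by simpa using h)
    fun j t ht => runs_three_block j t (by omega)

/-- The occurrences of `a ^ c` in `D` are separated by the words `ret (Θ p)`. -/
def HasReturns {β : Type} (c : ℕ) (Θ : ℕ → β) (ret : β → List Letter) : Prop :=
  ∀ p, ∃ x, IsNth (Runs c) p x ∧ IsNth (Runs c) (p + 1) (x + (ret (Θ p)).length) ∧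
    factorAt D x ((ret (Θ p)).length + c) = ret (Θ p) ++ List.replicate c .a

/-- The return words of `a`. -/
def returnOne : Letter → List Letter
  | .a => [.a, .b]
  | .b => [.a]

/-- The return words of `aa`. -/
def returnTwo : Letter₃ → List Letter
  | .a => [.a]
  | .b => [.a, .a, .b, .a, .b, .a, .b]
  | .c => [.a, .a, .b]

theorem isNth_block_one {j p : ℕ} (h : IsNth (Runs 1) p (2 * j)) :
    (D j = .a → IsNth (Runs 1) (p + 1) (2 * j + 2)) ∧
    (D j = .b → IsNth (Runs 1) (p + 1) (2 * j + 1) ∧ IsNth (Runs 1) (p + 2) (2 * j + 2)) := by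
  have hP := infinite_runs (Or.inl rfl : 1 = 1 ∨ 1 = 2)
  have h1 := D_odd j
  have h2 : D (2 * j + 2) = .a := D_even (j + 1)
  constructor
  · intro hj
    refine h.succ hP 2 (by omega) (runs_one.2 h2) fun e he he' => ?_
    obtain rfl : e = 1 := by omega
    simp [runs_one, h1, hj]
  · intro hj
    have s1 : IsNth (Runs 1) (p + 1) (2 * j + 1) :=
      h.succ hP 1 (by omega) (by simp [runs_one, h1, hj]) fun e he he' => by omega
    exact ⟨s1, s1.succ hP 1 (by omega) (runs_one.2 h2) fun e he he' => by omega⟩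

/-- The window from 8j + 2 to 8j + 10 begins at the aaa of σ³(x_j) and ends at that of the next
block. The distances are 1, 7 after a and 1, 3, 1, 3 after b, matching `phi₂`. -/
theorem isNth_block_two {j p : ℕ} (h : IsNth (Runs 2) p (8 * j + 2)) :
    (D j = .a → IsNth (Runs 2) (p + 1) (8 * j + 3) ∧ IsNth (Runs 2) (p + 2) (8 * j + 10)) ∧
    (D j = .b → IsNth (Runs 2) (p + 1) (8 * j + 3) ∧ IsNth (Runs 2) (p + 2) (8 * j + 6) ∧
      IsNth (Runs 2) (p + 3) (8 * j + 7) ∧ IsNth (Runs 2) (p + 4) (8 * j + 10)) := by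
  have hP := infinite_runs (Or.inr rfl : 2 = 1 ∨ 2 = 2)
  obtain ⟨h0, h1, h2, h3, h4, h5, h6, h7⟩ := D_block j
  obtain ⟨h8, h9, h10, h11, -⟩ := D_block (j + 1)
  rw [show 8 * (j + 1) = 8 * j + 8 by ring] at h8 h9 h10 h11
  have s1 : IsNth (Runs 2) (p + 1) (8 * j + 3) :=
    h.succ hP 1 (by omega) (runs_two.2 ⟨h3, h4⟩) fun e he he' => by omega
  constructor
  · intro hj
    rw [hj] at h7
    refine ⟨s1, s1.succ hP 7 (by omega) (runs_two.2 ⟨h10, h11⟩) fun e he he' => ?_⟩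
    rw [runs_two]
    interval_cases e <;> simp [h4, h5, h6, h7, h8, h9]
  · intro hj
    rw [hj] at h7
    have s2 : IsNth (Runs 2) (p + 2) (8 * j + 6) :=
      s1.succ hP 3 (by omega) (runs_two.2 ⟨h6, h7⟩) fun e he he' => by
        rw [runs_two]
        interval_cases e <;> simp [h4, h5]
    have s3 : IsNth (Runs 2) (p + 3) (8 * j + 7) :=
      s2.succ hP 1 (by omega) (runs_two.2 ⟨h7, h8⟩) fun e he he' => by omega
    refine ⟨s1, s2, s3, s3.succ hP 3 (by omega) (runs_two.2 ⟨h10, h11⟩) fun e he he' => ?_⟩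
    rw [runs_two]
    interval_cases e <;> simp [h8, h9]

theorem length_flatMap_factorAt_succ {α β : Type} (φ : α → List β) (u : ℕ → α) (j : ℕ) :
    ((factorAt u 0 (j + 1)).flatMap φ).length =
      ((factorAt u 0 j).flatMap φ).length + (φ (u j)).length := by
  simp [factorAt, List.range_succ, List.flatMap_append]

theorem hasReturns_one : HasReturns 1 Theta₁ returnOne := by
  have start : ∀ j, IsNth (Runs 1) ((factorAt D 0 j).flatMap phi₁).length (2 * j) := by
    intro j
    induction j with
    | zero => exact isNth_zero (runs_one.2 (D_even 0)) (by simp)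
    | succ j ih =>
      rw [length_flatMap_factorAt_succ]
      obtain ⟨ha, hb⟩ := isNth_block_one ih
      rcases (D j).eq_a_or_eq_b with hj | hj
      · rw [hj]; exact ha hj
      · rw [hj]; exact (hb hj).2
  intro p
  obtain ⟨j, q, hq, rfl⟩ := exists_block phi₁ (by intro x; cases x <;> simp [phi₁]) D p
  have hθ : Theta₁ _ = _ := substInf_block phi₁ (by intro x; cases x <;> simp [phi₁]) D j q hq
  rw [hθ]
  have hs := start j
  obtain ⟨ha, hb⟩ := isNth_block_one hs
  have h0 := D_even j
  have h1 := D_odd j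
  have h2 : D (2 * j + 2) = .a := D_even (j + 1)
  rcases (D j).eq_a_or_eq_b with hj | hj
  · simp only [hj, phi₁, List.length_cons, List.length_nil] at hq ⊢
    obtain rfl : q = 0 := by omega
    exact ⟨2 * j, hs, ha hj, by simp [factorAt, returnOne, List.range_succ, h0, h1, h2, hj]⟩
  · simp only [hj, phi₁, List.length_cons, List.length_nil] at hq ⊢
    obtain ⟨b1, b2⟩ := hb hj
    interval_cases q
    · exact ⟨2 * j, hs, b1, by simp [factorAt, returnOne, List.range_succ, h0, h1, hj]⟩
    · exact ⟨2 * j + 1, b1, b2, by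
        simp [factorAt, returnOne, List.range_succ, add_assoc, h1, h2, hj]⟩

theorem hasReturns_two : HasReturns 2 Theta₂ returnTwo := by
  have start : ∀ j, IsNth (Runs 2) ((factorAt D 0 j).flatMap phi₂).length (8 * j + 2) := by
    intro j
    induction j with
    | zero =>
      obtain ⟨-, h1, h2, h3, -⟩ := D_block 0
      refine isNth_zero (runs_two.2 ⟨h2, h3⟩) fun z hz => ?_
      rw [runs_two]
      interval_cases z <;> simp_all
    | succ j ih =>
      rw [length_flatMap_factorAt_succ]
      obtain ⟨ha, hb⟩ := isNth_block_two ih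
      rcases (D j).eq_a_or_eq_b with hj | hj
      · simpa [hj, phi₂, mul_add] using (ha hj).2
      · simpa [hj, phi₂, mul_add] using (hb hj).2.2.2
  intro p
  obtain ⟨j, q, hq, rfl⟩ := exists_block phi₂ (by intro x; cases x <;> simp [phi₂]) D p
  have hθ : Theta₂ _ = _ := substInf_block phi₂ (by intro x; cases x <;> simp [phi₂]) D j q hq
  rw [hθ]
  have hs := start j
  obtain ⟨ha, hb⟩ := isNth_block_two hs
  obtain ⟨h0, h1, h2, h3, h4, h5, h6, h7⟩ := D_block j
  obtain ⟨h8, h9, h10, h11, -⟩ := D_block (j + 1)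
  rw [show 8 * (j + 1) = 8 * j + 8 by ring] at h8 h9 h10 h11
  rcases (D j).eq_a_or_eq_b with hj | hj
  · rw [hj] at h7
    obtain ⟨b1, b2⟩ := ha hj
    simp only [hj, phi₂, List.length_cons, List.length_nil] at hq ⊢
    interval_cases q
    · exact ⟨8 * j + 2, hs, b1, by
        simp [factorAt, returnTwo, List.range_succ, add_assoc, h2, h3, h4]⟩
    · exact ⟨8 * j + 3, b1, b2, by
        simp [factorAt, returnTwo, List.range_succ, add_assoc, h3, h4, h5, h6, h7, h8, h9, h10,
          h11]⟩
  · rw [hj] at h7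
    obtain ⟨b1, b2, b3, b4⟩ := hb hj
    simp only [hj, phi₂, List.length_cons, List.length_nil] at hq ⊢
    interval_cases q
    · exact ⟨8 * j + 2, hs, b1, by
        simp [factorAt, returnTwo, List.range_succ, add_assoc, h2, h3, h4]⟩
    · exact ⟨8 * j + 3, b1, b2, by
        simp [factorAt, returnTwo, List.range_succ, add_assoc, h3, h4, h5, h6, h7]⟩
    · exact ⟨8 * j + 6, b2, b3, by
        simp [factorAt, returnTwo, List.range_succ, add_assoc, h6, h7, h8]⟩
    · exact ⟨8 * j + 7, b3, b4, by
        simp [factorAt, returnTwo, List.range_succ, add_assoc, h7, h8, h9, h10, h11]⟩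

/-! ### Gaps: comparison and enumeration -/

/-- The exponent sum of an element of the free group. -/
def exponentSum : FreeGroup Letter →* Multiplicative ℤ :=
  FreeGroup.lift fun _ => Multiplicative.ofAdd 1

theorem exponentSum_toFreeGroup (w : List Letter) :
    exponentSum (toFreeGroup w) = Multiplicative.ofAdd (w.length : ℤ) := by
  rw [exponentSum, toFreeGroup, FreeGroup.lift_mk]
  simp [List.map_map, Function.comp_def, ← ofAdd_nsmul]

/-- The sign convention of inverse words makes this one formula for separated, adjacent and
overlapping occurrences. -/
theorem exponentSum_gapBetween (n i j : ℕ) :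
    exponentSum (gapBetween n i j) = Multiplicative.ofAdd ((j : ℤ) - i - n) := by
  unfold gapBetween
  split_ifs with h
  · rw [exponentSum_toFreeGroup, length_factorAt]
    congr 1
    omega
  · rw [map_inv, exponentSum_toFreeGroup, length_factorAt, ← ofAdd_neg]
    congr 1
    omega

theorem gapBetween_congr {n i i' δ : ℕ} (h : ∀ t < n + δ, D (i + t) = D (i' + t)) :
    gapBetween n i (i + δ) = gapBetween n i' (i' + δ) := by
  unfold gapBetween
  by_cases hδ : n ≤ δ
  · rw [if_pos (by omega), if_pos (by omega)]
    congr 1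
    rw [show i + δ - (i + n) = δ - n by omega, show i' + δ - (i' + n) = δ - n by omega,
      factorAt_congr]
    intro t ht
    rw [add_assoc, add_assoc]
    exact h _ (by omega)
  · rw [if_neg (by omega), if_neg (by omega)]
    congr 2
    rw [show i + n - (i + δ) = n - δ by omega, show i' + n - (i' + δ) = n - δ by omega,
      factorAt_congr]
    intro t ht
    rw [add_assoc, add_assoc]
    exact h _ (by omega)

/-- A strictly increasing map that carries one set of places onto the other preserves the
enumeration. -/
theorem nth_occursAt {w : List Letter} {k c d : ℕ} (hc : c = 1 ∨ c = 2)
    (hocc : ∀ i, OccursAt D w i ↔ ∃ r, Runs c r ∧ i = 2 ^ k * r + d) (p : ℕ) :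
    Nat.nth (OccursAt D w) p = 2 ^ k * Nat.nth (Runs c) p + d := by
  have hk : 0 < 2 ^ k := by positivity
  have hmono : StrictMono fun r => 2 ^ k * r + d := fun r s hrs =>
    Nat.add_lt_add_right (Nat.mul_lt_mul_of_pos_left hrs hk) d
  have hiff : (fun r => OccursAt D w (2 ^ k * r + d)) = Runs c := by
    funext r
    apply propext
    rw [hocc]
    refine ⟨?_, fun h => ⟨r, h, rfl⟩⟩
    rintro ⟨s, hs, h⟩
    rwa [hmono.injective h]
  have hinf := infinite_runs hc
  have := Nat.nth_comp_of_strictMono (p := OccursAt D w) (n := p) hmono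
    (fun i hi => by
      obtain ⟨r, -, rfl⟩ := (hocc i).1 hi
      exact ⟨r, rfl⟩)
    (fun hfin => absurd ((hfin.preimage hmono.injective.injOn).subset fun r hr =>
      (hocc _).2 ⟨r, hr, rfl⟩) hinf)
  rw [← this, hiff]

section Gaps

variable {β : Type} {w : List Letter} {k c d : ℕ} {Θ : ℕ → β} {ret : β → List Letter}

theorem exists_G_eq (hc : c = 1 ∨ c = 2)
    (hocc : ∀ i, OccursAt D w i ↔ ∃ r, Runs c r ∧ i = 2 ^ k * r + d)
    (hΘ : HasReturns c Θ ret) (p : ℕ) : ∃ x,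
      factorAt D x ((ret (Θ p)).length + c) = ret (Θ p) ++ List.replicate c .a ∧
      G w (p + 1) = gapBetween w.length (2 ^ k * x + d)
        (2 ^ k * x + d + 2 ^ k * (ret (Θ p)).length) := by
  obtain ⟨x, h1, h2, h3⟩ := hΘ p
  refine ⟨x, h3, ?_⟩
  simp only [G, occurrence, Nat.add_sub_cancel, nth_occursAt hc hocc, h1.2, h2.2]
  congr 1
  ring

/-- The same return word followed by a^c stands at both places; by `hd` the common extension of its
σ^k-images covers both occurrences bounding the gap. -/
theorem G_congr (hc : c = 1 ∨ c = 2)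
    (hocc : ∀ i, OccursAt D w i ↔ ∃ r, Runs c r ∧ i = 2 ^ k * r + d)
    (hΘ : HasReturns c Θ ret) (hd : d + w.length + 1 ≤ (c + 1) * 2 ^ k) {p q : ℕ}
    (h : Θ p = Θ q) : G w (p + 1) = G w (q + 1) := by
  obtain ⟨x, hx, ex⟩ := exists_G_eq hc hocc hΘ p
  obtain ⟨y, hy, ey⟩ := exists_G_eq hc hocc hΘ q
  rw [ex, ey, h]
  rw [h, ← hy, factorAt_congr] at hx
  refine gapBetween_congr fun t ht => ?_
  rw [add_assoc, add_assoc]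
  refine D_agree k hx _ ?_
  rw [show ((ret (Θ q)).length + c + 1) * 2 ^ k =
    2 ^ k * (ret (Θ q)).length + (c + 1) * 2 ^ k by ring]
  omega

/-- The exponent sum of a gap is 2^k times the length of the return word, minus the length of ω. -/
theorem G_ne (hc : c = 1 ∨ c = 2)
    (hocc : ∀ i, OccursAt D w i ↔ ∃ r, Runs c r ∧ i = 2 ^ k * r + d)
    (hΘ : HasReturns c Θ ret) {p q : ℕ} (h : (ret (Θ p)).length ≠ (ret (Θ q)).length) :
    G w (p + 1) ≠ G w (q + 1) := by
  obtain ⟨x, -, ex⟩ := exists_G_eq hc hocc hΘ p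
  obtain ⟨y, -, ey⟩ := exists_G_eq hc hocc hΘ q
  rw [ex, ey]
  intro heq
  have he := congrArg exponentSum heq
  rw [exponentSum_gapBetween, exponentSum_gapBetween] at he
  have he' := Multiplicative.ofAdd.injective he
  have hk : 0 < 2 ^ k := by positivity
  exact h (Nat.eq_of_mul_eq_mul_left hk (by omega))

end Gaps

theorem Theta₁_initial : Theta₁ 0 = .a ∧ Theta₁ 1 = .b :=
  ⟨rfl, rfl⟩

/-- Θ₂ begins abacac, so c first appears at index 3, which is why G₄ represents it. -/
theorem Theta₂_initial : Theta₂ 0 = .a ∧ Theta₂ 1 = .b ∧ Theta₂ 3 = .c :=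
  ⟨rfl, rfl, rfl⟩

end PeriodDoubling

theorem theorem5p2 (w : List PeriodDoubling.Letter) (hne : w ≠ [])
    (hw : PeriodDoubling.IsFactor w PeriodDoubling.D) :
    {i | PeriodDoubling.OccursAt PeriodDoubling.D w i}.Infinite ∧
    (∀ m : ℕ, 1 ≤ m → PeriodDoubling.Env w hw = PeriodDoubling.E m 1 →
      PeriodDoubling.G w 1 ≠ PeriodDoubling.G w 2 ∧
      ∀ p : ℕ, PeriodDoubling.G w (p + 1) =
        PeriodDoubling.rename₂ (PeriodDoubling.G w 1) (PeriodDoubling.G w 2)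
          (PeriodDoubling.Theta₁ p)) ∧
    (∀ m : ℕ, 1 ≤ m → PeriodDoubling.Env w hw = PeriodDoubling.E m 2 →
      PeriodDoubling.G w 1 ≠ PeriodDoubling.G w 2 ∧
      PeriodDoubling.G w 1 ≠ PeriodDoubling.G w 4 ∧
      PeriodDoubling.G w 2 ≠ PeriodDoubling.G w 4 ∧
      ∀ p : ℕ, PeriodDoubling.G w (p + 1) =
        PeriodDoubling.rename₃ (PeriodDoubling.G w 1) (PeriodDoubling.G w 2)
          (PeriodDoubling.G w 4) (PeriodDoubling.Theta₂ p)) := by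
  open PeriodDoubling in
  obtain ⟨k, c, d, hc, hd, hocc, henv⟩ := exists_envelope hne hw
  refine ⟨?_, ?_, ?_⟩
  · have hk : 0 < 2 ^ k := by positivity
    refine ((infinite_runs hc).image (f := fun r => 2 ^ k * r + d) ?_).mono ?_
    · intro x _ y _ h
      exact Nat.eq_of_mul_eq_mul_left hk (Nat.add_right_cancel h)
    · rintro _ ⟨r, hr, rfl⟩
      exact (hocc _).2 ⟨r, hr, rfl⟩
  · intro m hm hE
    obtain ⟨m, rfl⟩ : ∃ m', m = m' + 1 := ⟨m - 1, by omega⟩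
    obtain rfl : c = 1 := by
      rcases hc with rfl | rfl
      · rfl
      · exact absurd (hE.symm.trans henv) (E_one_ne_E_two m k)
    obtain ⟨t0, t1⟩ := Theta₁_initial
    refine ⟨G_ne hc hocc hasReturns_one (p := 0) (q := 1) (by simp [t0, t1, returnOne]),
      fun p => ?_⟩
    cases hp : Theta₁ p
    · exact G_congr hc hocc hasReturns_one hd (q := 0) (hp.trans t0.symm)
    · exact G_congr hc hocc hasReturns_one hd (q := 1) (hp.trans t1.symm)
  · intro m hm hE
    obtain ⟨m, rfl⟩ : ∃ m', m = m' + 1 := ⟨m - 1, by omega⟩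
    obtain rfl : c = 2 := by
      rcases hc with rfl | rfl
      · exact absurd (henv.symm.trans hE) (E_one_ne_E_two k m)
      · rfl
    obtain ⟨t0, t1, t3⟩ := Theta₂_initial
    refine ⟨G_ne hc hocc hasReturns_two (p := 0) (q := 1) (by simp [t0, t1, returnTwo]),
      G_ne hc hocc hasReturns_two (p := 0) (q := 3) (by simp [t0, t3, returnTwo]),
      G_ne hc hocc hasReturns_two (p := 1) (q := 3) (by simp [t1, t3, returnTwo]),
      fun p => ?_⟩
    cases hp : Theta₂ p
    · exact G_congr hc hocc hasReturns_two hd (q := 0) (hp.trans t0.symm)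
    · exact G_congr hc hocc hasReturns_two hd (q := 1) (hp.trans t1.symm)
    · exact G_congr hc hocc hasReturns_two hd (q := 3) (hp.trans t3.symm)
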